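/- Let $L$ be a signature of finitary operation symbols and let $\mathbb V$ be a variety of $L$-algebras (the class of all $L$-algebras satisfying a given set of equations). Suppose that $\mathbb V$ is pointed, i.e. it has exactly one constant (there is a closed term, and any two closed terms are equal in all the algebras of $\mathbb V$), and that $\mathbb V$ is congruence modular, i.e. the lattice of congruences of every algebra in $\mathbb V$ is modular. Let $X$ be a non-empty algebra in $\mathbb V$. Call an $L$-homomorphism $p : X\times X\times X\to X$ a Mal'tsev operation on $X$ if $p(x,y,y)=x$ and $p(x,x,y)=y$ for all $x,y\in X$, and call $X$ affine in $\mathbb V$ if there is a Mal'tsev operation on $X$. Then $X$ is affine in $\mathbb V$ if and only if the diagonal $\{(x,x) : x\in X\}$ is a congruence class, i.e. there is a congruence on the algebra $X\times X$ one of whose equivalence classes is exactly the diagonal. Moreover, any Mal'tsev operation $p$ on $X$ is autonomous, i.e. $p(p(x,y,z),t,s)=p(x,y,p(z,t,s))$ and $p(x,y,z)=p(z,y,x)$ for all $x,y,z,t,s\in X$. -/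

import Mathlib

universe u v w

namespace UnivAlg

/-- Componentwise operations on the product of two algebras. -/
instance prodStructure (L : FirstOrder.Language.{u, v}) (A B : Type*) [L.Structure A] [L.Structure B] :
    L.Structure (A × B) where
  funMap f x :=
    (FirstOrder.Language.Structure.funMap f fun i => (x i).1, FirstOrder.Language.Structure.funMap f fun i => (x i).2)
  RelMap r x :=
    (FirstOrder.Language.Structure.RelMap r fun i => (x i).1) ∧ FirstOrder.Language.Structure.RelMap r fun i => (x i).2

/-- A congruence: an equivalence relation compatible with all the operations. -/
@[ext]
structure Congruence (L : FirstOrder.Language.{u, v}) (A : Type*) [L.Structure A] extends Setoid A where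
  compatible : ∀ {n : ℕ} (f : L.Functions n) (x y : Fin n → A), (∀ i, toSetoid (x i) (y i)) →
    toSetoid (FirstOrder.Language.Structure.funMap f x) (FirstOrder.Language.Structure.funMap f y)

namespace Congruence

variable {L : FirstOrder.Language.{u, v}} {A : Type*} [L.Structure A]

theorem toSetoid_injective :
    Function.Injective (toSetoid : Congruence L A → Setoid A) := by
  rintro ⟨r, _⟩ ⟨s, _⟩ h
  cases h
  rfl

/-- Congruences are ordered by inclusion. -/
instance : PartialOrder (Congruence L A) :=
  PartialOrder.lift toSetoid toSetoid_injective

/-- The infimum of a set of congruences is their intersection. -/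
instance : InfSet (Congruence L A) where
  sInf S :=
    { toSetoid := sInf (toSetoid '' S)
      compatible := by
        intro n f x y h
        simp only [Setoid.sInf_def] at h ⊢
        simp only [sInf_apply, iInf_apply, iInf_Prop_eq] at h ⊢
        rintro ⟨_, _, ⟨θ, hθ, rfl⟩, rfl⟩
        exact θ.compatible f x y fun i => h i ⟨_, _, ⟨θ, hθ, rfl⟩, rfl⟩ }

theorem isGLB_sInf (S : Set (Congruence L A)) : IsGLB S (sInf S) := by
  constructor
  · intro θ hθ
    exact sInf_le (α := Setoid A) ⟨θ, hθ, rfl⟩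
  · intro θ hθ
    refine le_sInf (α := Setoid A) ?_
    rintro _ ⟨φ, hφ, rfl⟩
    exact hθ hφ

/-- The complete lattice of congruences; joins are least upper bounds among congruences. -/
instance : CompleteLattice (Congruence L A) :=
  completeLatticeOfInf _ isGLB_sInf

end Congruence

/-- A variety of algebras of signature `L`, presented by a set of equations `s = t` between
terms in countably many variables. -/
structure Variety (L : FirstOrder.Language.{u, v}) where
  equations : Set (L.Term ℕ × L.Term ℕ)

namespace Variety

variable {L : FirstOrder.Language.{u, v}}

/-- `A` is an algebra in the variety `V`: it satisfies all the equations of `V`. -/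
def Contains (V : Variety L) (A : Type*) [L.Structure A] : Prop :=
  ∀ e ∈ V.equations, ∀ a : ℕ → A, e.1.realize a = e.2.realize a

/-- Every algebra in `V` has a modular lattice of congruences. -/
def IsCongruenceModular (V : Variety L) : Prop :=
  ∀ (A : Type (max u w)) [L.Structure A], V.Contains A → IsModularLattice (Congruence L A)

/-- `V` has exactly one constant: there is a closed term `c`, and every closed term is equal
to `c` in all the algebras in `V`. -/
def IsPointed (V : Variety L) : Prop :=
  ∃ c : L.Term Empty, ∀ d : L.Term Empty, ∀ (A : Type (max u w)) [L.Structure A],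
    V.Contains A → d.realize (Empty.elim : Empty → A) = c.realize Empty.elim

end Variety

/-- `p` is an internal Mal'tsev operation on `X`: a homomorphism `X × X × X → X` satisfying the
Mal'tsev identities. -/
def IsMaltsev {L : FirstOrder.Language.{u, v}} {X : Type*} [L.Structure X]
    (p : FirstOrder.Language.Hom L (X × X × X) X) : Prop :=
  (∀ x y, p (x, y, y) = x) ∧ ∀ x y, p (x, x, y) = y

/-- An autonomous ternary operation: associative and commutative. -/
def IsAutonomous {X : Type*} (p : X × X × X → X) : Prop :=
  (∀ x y z t s, p (p (x, y, z), t, s) = p (x, y, p (z, t, s))) ∧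
    ∀ x y z, p (x, y, z) = p (z, y, x)

/-- An affine algebra: one that admits an internal Mal'tsev operation. -/
def IsAffine (L : FirstOrder.Language.{u, v}) (X : Type*) [L.Structure X] : Prop :=
  ∃ p : FirstOrder.Language.Hom L (X × X × X) X, IsMaltsev p

end UnivAlg

/-! Modularity enters in two ways. Through the shifting lemma, applied to kernels on `X × X × X` and
the fifth power of `X`, it forces a Mal'tsev homomorphism to be cancellative, associative and
commutative. The constant `o` is a one-element subalgebra, so `(x, y) ↦ p (x, y, o)` is then a
homomorphism whose kernel has the diagonal as a class.

Conversely, a diagonal class gives the term condition on `X`. Modularity of the algebra of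
quaternary term functions supplies a Day chain; walking along it with the term condition builds a
term `s` with `s(a, a) = o` and `s(a, o) = a` (`exists_subtraction_term`). With `s` as subtraction,
each `(x, y, z)` has exactly one `w` with `(w, z)` congruent to `(x, y)`. This `w` is `p (x, y, z)`,
and its uniqueness makes `p` a homomorphism. -/

namespace UnivAlg

open FirstOrder FirstOrder.Language FirstOrder.Language.Structure

/-! ### Joins of congruences and the shifting lemma. -/

namespace Congruence

variable {L : FirstOrder.Language.{u, v}} {A : Type*} [L.Structure A]

theorem le_iff {θ φ : Congruence L A} :
    θ ≤ φ ↔ ∀ a b, θ.toSetoid a b → φ.toSetoid a b := by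
  constructor
  · intro h a b hab
    exact h hab
  · intro h a b hab
    exact h a b hab

theorem inf_apply {θ φ : Congruence L A} {a b : A} :
    (θ ⊓ φ).toSetoid a b ↔ θ.toSetoid a b ∧ φ.toSetoid a b := by
  constructor
  · intro h
    exact ⟨le_iff.1 inf_le_left a b h, le_iff.1 inf_le_right a b h⟩
  · rintro ⟨h₁, h₂⟩
    let ψ : Congruence L A :=
      { toSetoid := θ.toSetoid ⊓ φ.toSetoid
        compatible := fun f x y hxy =>
          ⟨θ.compatible f x y fun i => (hxy i).1, φ.compatible f x y fun i => (hxy i).2⟩ }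
    have hψ : ψ ≤ θ ⊓ φ :=
      le_inf (le_iff.2 fun a b h => h.1) (le_iff.2 fun a b h => h.2)
    exact le_iff.1 hψ a b ⟨h₁, h₂⟩

/-- The kernel of a map that commutes with the operations. -/
def ker {B : Type*} [L.Structure B] (h : A → B)
    (hh : ∀ {n : ℕ} (f : L.Functions n) (x : Fin n → A),
      h (funMap f x) = funMap f fun i => h (x i)) : Congruence L A where
  toSetoid := Setoid.ker h
  compatible f x y hxy := by
    have hxy' : ∀ i, h (x i) = h (y i) := hxy
    change h _ = h _
    simp only [hh, hxy']

theorem ker_apply {B : Type*} [L.Structure B] {h : A → B}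
    {hh : ∀ {n : ℕ} (f : L.Functions n) (x : Fin n → A),
      h (funMap f x) = funMap f fun i => h (x i)} {a b : A} :
    (ker h hh).toSetoid a b ↔ h a = h b :=
  Iff.rfl

/-- Pairs in a join of congruences are linked by a finite chain. -/
theorem reflTransGen_of_sup {α β : Congruence L A} {a b : A} (hab : (α ⊔ β).toSetoid a b) :
    Relation.ReflTransGen (fun x y => α.toSetoid x y ∨ β.toSetoid x y) a b := by
  set ρ : A → A → Prop := fun x y => α.toSetoid x y ∨ β.toSetoid x y with hρ
  have hsymm : ∀ x y, ρ x y → ρ y x := by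
    rintro x y (h | h)
    · exact Or.inl (α.toSetoid.symm h)
    · exact Or.inr (β.toSetoid.symm h)
  have hstep : ∀ {n : ℕ} (f : L.Functions n) (z : Fin n → A) (i : Fin n) (c d : A),
      ρ c d → ρ (funMap f (Function.update z i c)) (funMap f (Function.update z i d)) := by
    intro n f z i c d
    have key : ∀ θ : Congruence L A, θ.toSetoid c d →
        θ.toSetoid (funMap f (Function.update z i c)) (funMap f (Function.update z i d)) := by
      intro θ hcd
      refine θ.compatible f _ _ fun j => ?_
      by_cases hj : j = i
      · subst hj
        simpa using hcd
      · simp [hj]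
    exact Or.imp (key α) (key β)
  let ψ : Congruence L A :=
    { toSetoid :=
        { r := Relation.ReflTransGen ρ
          iseqv :=
            { refl := fun _ => Relation.ReflTransGen.refl
              symm := fun h => by
                induction h with
                | refl => exact Relation.ReflTransGen.refl
                | tail _ h ih => exact Relation.ReflTransGen.head (hsymm _ _ h) ih
              trans := Relation.ReflTransGen.trans } }
      compatible := by
        intro n f x y hxy
        have hxy' : ∀ i, Relation.ReflTransGen ρ (x i) (y i) := hxy
        -- The arguments are changed one at a time: a link in a single argument stays a link under
        -- `f`, whereas links of different kinds in several arguments cannot be combined.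
        have key : ∀ s : Finset (Fin n),
            Relation.ReflTransGen ρ (funMap f x) (funMap f (s.piecewise y x)) := by
          intro s
          induction s using Finset.induction_on with
          | empty => simp [Relation.ReflTransGen.refl]
          | insert i s hi ih =>
            refine ih.trans ?_
            have h := Relation.ReflTransGen.lift (p := ρ)
              (fun c => funMap f (Function.update (s.piecewise y x) i c))
              (fun c d hcd => hstep f _ i c d hcd) _ _ (hxy' i)
            rw [Finset.piecewise_insert]
            have hx : Function.update (s.piecewise y x) i (x i) = s.piecewise y x := by
              rw [← Finset.piecewise_eq_of_notMem s y x hi, Function.update_eq_self]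
            simpa only [Function.onFun, hx] using h
        simpa using key Finset.univ }
  have hle : α ⊔ β ≤ ψ :=
    sup_le (le_iff.2 fun _ _ h => Relation.ReflTransGen.single (Or.inl h))
      (le_iff.2 fun _ _ h => Relation.ReflTransGen.single (Or.inr h))
  exact le_iff.1 hle a b hab

/-- Gumm's shifting lemma. -/
theorem shifting [IsModularLattice (Congruence L A)] {R S T : Congruence L A}
    (hRS : ∀ a b, R.toSetoid a b → S.toSetoid a b → T.toSetoid a b) {a b c d : A}
    (hab : S.toSetoid a b) (hdc : S.toSetoid d c) (had : R.toSetoid a d)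
    (hR : R.toSetoid b c) (hT : T.toSetoid b c) : T.toSetoid a d := by
  have hsup : ((T ⊓ R) ⊔ S).toSetoid a d :=
    Setoid.trans' _ (le_iff.1 le_sup_right a b hab)
      (Setoid.trans' _ (le_iff.1 le_sup_left b c (inf_apply.2 ⟨hT, hR⟩))
        (Setoid.symm' _ (le_iff.1 le_sup_right d c hdc)))
  -- Modular law for `T ⊓ R ≤ R`; the remaining term `S ⊓ R` lies in `T` by `hRS`.
  have hle : ((T ⊓ R) ⊔ S) ⊓ R ≤ T :=
    (sup_inf_le_assoc_of_le S inf_le_right).trans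
      (sup_le inf_le_left (le_iff.2 fun x y h => hRS x y (inf_apply.1 h).2 (inf_apply.1 h).1))
  exact le_iff.1 hle a d (inf_apply.2 ⟨hsup, had⟩)

/-- Term functions preserve congruences. -/
theorem realize {ι : Type*} (θ : Congruence L A) (t : L.Term ι) {v w : ι → A}
    (h : ∀ i, θ.toSetoid (v i) (w i)) : θ.toSetoid (t.realize v) (t.realize w) := by
  induction t with
  | var i => exact h i
  | func f ts ih => exact θ.compatible f _ _ ih

end Congruence

variable {L : FirstOrder.Language.{u, v}}

theorem realize_prodMk {A B ι : Type*} [L.Structure A] [L.Structure B] (t : L.Term ι)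
    (v : ι → A) (w : ι → B) :
    t.realize (fun i => (v i, w i)) = (t.realize v, t.realize w) := by
  induction t with
  | var i => rfl
  | func f ts ih =>
    simp only [Term.realize, ih]
    rfl

theorem Variety.Contains.prod {V : Variety L} {A B : Type*} [L.Structure A] [L.Structure B]
    (hA : V.Contains A) (hB : V.Contains B) : V.Contains (A × B) := fun e he a => by
  rw [show a = fun i => ((a i).1, (a i).2) from rfl, realize_prodMk, realize_prodMk,
    hA e he, hB e he]

/-! ### Mal'tsev homomorphisms are autonomous. -/

section Autonomy

variable {X : Type*} [L.Structure X]

theorem hom_map_tuple (p : FirstOrder.Language.Hom L (X × X × X) X) {n : ℕ} (f : L.Functions n)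
    (x y z : Fin n → X) :
    p (funMap f x, funMap f y, funMap f z) = funMap f fun i => p (x i, y i, z i) :=
  p.map_fun f fun i => (x i, y i, z i)

variable {p : FirstOrder.Language.Hom L (X × X × X) X}

/-- Shifting replaces the first coordinate `x` by `y`, where `p (y, y, z) = z`. -/
theorem IsMaltsev.right_cancel [IsModularLattice (Congruence L (X × X × X))] (hp : IsMaltsev p)
    {x y z z' : X} (h : p (x, y, z) = p (x, y, z')) : z = z' := by
  have key := Congruence.shifting
    (R := Congruence.ker (fun a : X × X × X => (a.1, a.2.1)) fun _ _ => rfl)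
    (S := Congruence.ker (fun a : X × X × X => a.2) fun _ _ => rfl)
    (T := Congruence.ker p fun f a => p.map_fun f a)
    (a := (y, y, z)) (b := (x, y, z)) (c := (x, y, z')) (d := (y, y, z'))
    (by
      rintro ⟨a₁, a₂, a₃⟩ ⟨b₁, b₂, b₃⟩ h₁ h₂
      simp only [Congruence.ker_apply, Prod.mk.injEq] at h₁ h₂ ⊢
      rw [h₁.1, h₂.1, h₂.2])
    rfl rfl rfl rfl h
  simpa only [Congruence.ker_apply, hp.2] using key

theorem IsMaltsev.left_cancel [IsModularLattice (Congruence L (X × X × X))] (hp : IsMaltsev p)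
    {x x' y z : X} (h : p (x, y, z) = p (x', y, z)) : x = x' := by
  have key := Congruence.shifting
    (R := Congruence.ker (fun a : X × X × X => a.2) fun _ _ => rfl)
    (S := Congruence.ker (fun a : X × X × X => (a.1, a.2.1)) fun _ _ => rfl)
    (T := Congruence.ker p fun f a => p.map_fun f a)
    (a := (x, y, y)) (b := (x, y, z)) (c := (x', y, z)) (d := (x', y, y))
    (by
      rintro ⟨a₁, a₂, a₃⟩ ⟨b₁, b₂, b₃⟩ h₁ h₂
      simp only [Congruence.ker_apply, Prod.mk.injEq] at h₁ h₂ ⊢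
      rw [h₂.1, h₁.1, h₁.2])
    rfl rfl rfl rfl h
  simpa only [Congruence.ker_apply, hp.1] using key

/-- `R` and `T` are the kernels of the two bracketings. The point `d` has the same right bracketing
as `a`, and its left bracketing is already the desired value. Cancellation makes `R ⊓ S` trivial. -/
theorem IsMaltsev.assoc [IsModularLattice (Congruence L (X × X × X))]
    [IsModularLattice (Congruence L (X × X × X × X × X))] (hp : IsMaltsev p) (x y z t s : X) :
    p (p (x, y, z), t, s) = p (x, y, p (z, t, s)) := by
  have key := Congruence.shifting (L := L) (A := X × X × X × X × X)
    (R := Congruence.ker (B := X)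
      (fun a : X × X × X × X × X => p (a.1, a.2.1, p (a.2.2.1, a.2.2.2.1, a.2.2.2.2)))
      fun f a => by
        simp only [← hom_map_tuple]
        rfl)
    (S := Congruence.ker (B := X × X × X × X)
      (fun a : X × X × X × X × X => (a.1, a.2.1, a.2.2.1, a.2.2.2.1)) fun _ _ => rfl)
    (T := Congruence.ker (B := X)
      (fun a : X × X × X × X × X => p (p (a.1, a.2.1, a.2.2.1), a.2.2.2.1, a.2.2.2.2))
      fun f a => by
        simp only [← hom_map_tuple]
        rfl)
    (a := (x, y, z, t, s)) (b := (x, y, z, t, t)) (c := (x, y, y, y, z))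
    (d := (x, y, y, y, p (z, t, s)))
    (by
      rintro ⟨a₁, a₂, a₃, a₄, a₅⟩ ⟨b₁, b₂, b₃, b₄, b₅⟩ h₁ h₂
      simp only [Congruence.ker_apply, Prod.mk.injEq] at h₁ h₂ ⊢
      obtain ⟨rfl, rfl, rfl, rfl⟩ := h₂
      rw [hp.right_cancel (hp.right_cancel h₁)])
    rfl rfl (by simp only [Congruence.ker_apply, hp.2])
    (by simp only [Congruence.ker_apply, hp.1, hp.2])
    (by simp only [Congruence.ker_apply, hp.1])
  simpa only [Congruence.ker_apply, hp.1, hp.2] using key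

/-- Same scheme as for associativity, with `p` read backwards as `R`. -/
theorem IsMaltsev.comm [IsModularLattice (Congruence L (X × X × X))] (hp : IsMaltsev p)
    (x y z : X) : p (x, y, z) = p (z, y, x) := by
  have key := Congruence.shifting
    (R := Congruence.ker (fun a : X × X × X => p (a.2.2, a.2.1, a.1))
      fun f a => by
        simp only [← hom_map_tuple]
        rfl)
    (S := Congruence.ker (fun a : X × X × X => (a.1, a.2.1)) fun _ _ => rfl)
    (T := Congruence.ker p fun f a => p.map_fun f a)
    (a := (x, y, z)) (b := (x, y, y)) (c := (y, y, x)) (d := (y, y, p (z, y, x)))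
    (by
      rintro ⟨a₁, a₂, a₃⟩ ⟨b₁, b₂, b₃⟩ h₁ h₂
      simp only [Congruence.ker_apply, Prod.mk.injEq] at h₁ h₂ ⊢
      obtain ⟨rfl, rfl⟩ := h₂
      rw [hp.left_cancel h₁])
    rfl rfl (by simp only [Congruence.ker_apply, hp.1])
    (by simp only [Congruence.ker_apply, hp.1, hp.2])
    (by simp only [Congruence.ker_apply, hp.1, hp.2])
  simpa only [Congruence.ker_apply, hp.2] using key

end Autonomy

/-- If `o` is a one-element subalgebra, an autonomous Mal'tsev homomorphism makes the diagonal a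
class of the kernel of `(x, y) ↦ p (x, y, o)`. -/
theorem IsMaltsev.exists_congruence_diagonal {X : Type*} [L.Structure X]
    {p : FirstOrder.Language.Hom L (X × X × X) X} (hp : IsMaltsev p) (ha : IsAutonomous p) (o : X)
    (ho : ∀ {n : ℕ} (f : L.Functions n), funMap f (fun _ => o) = o) :
    ∃ θ : Congruence L (X × X), Set.diagonal X ∈ θ.toSetoid.classes := by
  refine ⟨Congruence.ker (fun a : X × X => p (a.1, a.2, o)) fun f a => ?_, (o, o), ?_⟩
  · rw [← hom_map_tuple, ho]
    rfl
  · ext ⟨x, y⟩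
    change x = y ↔ p (x, y, o) = p (o, o, o)
    rw [hp.2]
    constructor
    · rintro rfl
      exact hp.2 _ _
    · intro h
      -- If `p (x, y, o) = o`, the two bracketings of `x, y, o, o, y` evaluate to `y` and `x`.
      have := ha.1 x y o o y
      rw [h, hp.2, hp.1] at this
      exact this.symm

/-! ### Term functions and Day's chain. -/

/-- The algebra of term functions on `X` in variables indexed by `ι`. -/
def TermFunction (L : FirstOrder.Language.{u, v}) (ι X : Type*) [L.Structure X] :=
  {f : (ι → X) → X // ∃ t : L.Term ι, ∀ v, f v = t.realize v}

namespace TermFunction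

variable {ι X : Type*} [L.Structure X]

/-- The term function of a term. -/
def ofTerm (t : L.Term ι) : TermFunction L ι X := ⟨t.realize, t, fun _ => rfl⟩

instance [L.IsAlgebraic] : L.Structure (TermFunction L ι X) where
  funMap f x :=
    ⟨fun v => funMap f fun i => (x i).1 v, Term.func f fun i => (x i).2.choose, fun v => by
      simp only [Term.realize]
      congr 1
      funext i
      exact (x i).2.choose_spec v⟩
  RelMap r _ := isEmptyElim r

variable [L.IsAlgebraic]

theorem realize_apply {κ : Type*} (t : L.Term κ) (a : κ → TermFunction L ι X) (v : ι → X) :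
    (t.realize a).1 v = t.realize fun k => (a k).1 v := by
  induction t with
  | var i => rfl
  | func f ts ih =>
    simp only [Term.realize, ← ih]
    rfl

theorem contains {V : Variety L} (hX : V.Contains X) : V.Contains (TermFunction L ι X) :=
  fun e he a => Subtype.ext <| funext fun v => by
    rw [realize_apply, realize_apply, hX e he]

/-- The congruence of agreement on a set of tuples. -/
def agree (s : Set (ι → X)) : Congruence L (TermFunction L ι X) where
  toSetoid :=
    { r := fun f g => ∀ v ∈ s, f.1 v = g.1 v
      iseqv :=
        { refl := fun _ _ _ => rfl
          symm := fun h v hv => (h v hv).symm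
          trans := fun h₁ h₂ v hv => (h₁ v hv).trans (h₂ v hv) } }
  compatible f _ _ h := fun v hv => congrArg (funMap f) (funext fun i => h i v hv)

/-- Day's chain of quaternary term functions, as an induction principle: a property of the first
projection that is preserved by the two kinds of steps holds of the last projection. -/
theorem day_induction [IsModularLattice (Congruence L (TermFunction L (Fin 4) X))]
    (P : TermFunction L (Fin 4) X → Prop) (h₀ : P (ofTerm (Term.var 0)))
    (hS : ∀ f g, P f → (∀ a b, f.1 ![a, b, b, a] = a) → (∀ a b, g.1 ![a, b, b, a] = a) →
      (∀ a c, f.1 ![a, a, c, c] = g.1 ![a, a, c, c]) → P g)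
    (hT : ∀ f g, P f → (∀ a b c, f.1 ![a, b, b, c] = g.1 ![a, b, b, c]) → P g) :
    P (ofTerm (Term.var 3)) := by
  let R : Congruence L (TermFunction L (Fin 4) X) := agree {v | ∃ a b, v = ![a, b, b, a]}
  let S : Congruence L (TermFunction L (Fin 4) X) := agree {v | ∃ a c, v = ![a, a, c, c]}
  let T : Congruence L (TermFunction L (Fin 4) X) := agree {v | ∃ a b c, v = ![a, b, b, c]}
  have hTR : T ≤ R := Congruence.le_iff.2 fun f g h v ⟨a, b, hv⟩ => h v ⟨a, b, a, hv⟩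
  have hsup : (T ⊔ S).toSetoid (ofTerm (Term.var 0)) (ofTerm (Term.var 3)) := by
    refine Setoid.trans' _ (y := ofTerm (Term.var 1)) (Congruence.le_iff.1 le_sup_right _ _ ?_)
      (Setoid.trans' _ (y := ofTerm (Term.var 2)) (Congruence.le_iff.1 le_sup_left _ _ ?_)
        (Congruence.le_iff.1 le_sup_right _ _ ?_))
    · rintro _ ⟨a, c, rfl⟩
      rfl
    · rintro _ ⟨a, b, c, rfl⟩
      rfl
    · rintro _ ⟨a, c, rfl⟩
      rfl
  have hR : R.toSetoid (ofTerm (Term.var 0)) (ofTerm (Term.var 3)) := by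
    rintro _ ⟨a, b, rfl⟩
    rfl
  -- As `T ≤ R`, modularity gives `(T ⊔ S) ⊓ R ≤ T ⊔ (S ⊓ R)`, so the whole chain stays in one
  -- `R`-class: every member sends `(a, b, b, a)` to `a`.
  have hchain := Congruence.reflTransGen_of_sup (Congruence.le_iff.1
    (sup_inf_le_assoc_of_le S hTR) _ _ (Congruence.inf_apply.2 ⟨hsup, hR⟩))
  have key : ∀ g, Relation.ReflTransGen (fun f g => T.toSetoid f g ∨ (S ⊓ R).toSetoid f g)
      (ofTerm (Term.var 0)) g → P g ∧ ∀ a b, g.1 ![a, b, b, a] = a := by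
    intro g hg
    induction hg with
    | refl => exact ⟨h₀, fun _ _ => rfl⟩
    | @tail f g _ h ih =>
      obtain h | h := h
      · exact ⟨hT f g ih.1 fun a b c => h _ ⟨a, b, c, rfl⟩,
          fun a b => (h _ ⟨a, b, a, rfl⟩).symm.trans (ih.2 a b)⟩
      · obtain ⟨h₁, h₂⟩ := Congruence.inf_apply.1 h
        have hg : ∀ a b, g.1 ![a, b, b, a] = a :=
          fun a b => (h₂ _ ⟨a, b, rfl⟩).symm.trans (ih.2 a b)
        exact ⟨hS f g ih.1 ih.2 hg fun a c => h₁ _ ⟨a, c, rfl⟩, hg⟩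
  exact (key _ hchain).1

end TermFunction

/-! ### From a diagonal class to a Mal'tsev homomorphism. -/

section Diagonal

variable {X : Type*} [L.Structure X] {θ : Congruence L (X × X)}

theorem Congruence.diagonal_iff (hθ : Set.diagonal X ∈ θ.toSetoid.classes) {a b : X × X}
    (ha : a.1 = a.2) : θ.toSetoid a b ↔ b.1 = b.2 := by
  obtain ⟨c, hc⟩ := hθ
  have key : ∀ x : X × X, x.1 = x.2 ↔ θ.toSetoid x c := fun x => Set.ext_iff.1 hc x
  rw [key b]
  exact ⟨fun h => Setoid.trans' _ (Setoid.symm' _ h) ((key a).1 ha),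
    fun h => Setoid.trans' _ ((key a).1 ha) (Setoid.symm' _ h)⟩

/-- The term condition. -/
theorem Congruence.term_condition (hθ : Set.diagonal X ∈ θ.toSetoid.classes) {ι : Type*}
    (t : L.Term ι) {v v' w w' : ι → X}
    (h : ∀ i, (v i = w i ∧ v' i = w' i) ∨ (v i = v' i ∧ w i = w' i))
    (ht : t.realize v = t.realize v') : t.realize w = t.realize w' := by
  -- Each pair `(v i, v' i)` either equals `(w i, w' i)` or is diagonal along with it, hence is
  -- congruent to it.
  have key := θ.realize t (v := fun i => (v i, v' i)) (w := fun i => (w i, w' i)) fun i => by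
    obtain ⟨h₁, h₂⟩ | ⟨h₁, h₂⟩ := h i
    · rw [h₁, h₂]
    · exact (diagonal_iff hθ h₁).2 h₂
  rw [realize_prodMk, realize_prodMk] at key
  exact (diagonal_iff hθ ht).1 key

/-- In a congruence modular setting, a diagonal class yields a binary subtraction term. -/
theorem exists_subtraction_term [L.IsAlgebraic]
    [IsModularLattice (Congruence L (TermFunction L (Fin 4) X))]
    (hθ : Set.diagonal X ∈ θ.toSetoid.classes) (c : L.Term Empty) (o : X)
    (hc : c.realize Empty.elim = o) :
    ∃ s : L.Term (Fin 2), (∀ a : X, s.realize ![a, a] = o) ∧ ∀ a : X, s.realize ![a, o] = a := by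
  refine TermFunction.day_induction (L := L) (X := X)
    (fun f => ∃ s : L.Term (Fin 2), (∀ a : X, s.realize ![a, a] = o) ∧
      ∀ a : X, s.realize ![a, o] = f.1 ![o, o, o, a]) ?_ ?_ ?_
  · refine ⟨c.relabel Empty.elim, fun a => ?_, fun a => ?_⟩
    · rw [Term.realize_relabel, ← hc]
      congr 1
      exact Subsingleton.elim _ _
    · rw [Term.realize_relabel]
      refine Eq.trans ?_ hc
      congr 1
      exact Subsingleton.elim _ _
  · rintro ⟨f, tf, hf⟩ ⟨g, tg, hg⟩ ⟨s, hs₁, hs₂⟩ hfR hgR hS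
    simp only [hf, hg] at hs₂ hfR hgR hS
    -- On `(a, o)`, the term condition turns `f(s, o, o, s) = s = f(o, o, o, a)` into `r = f(o, o,
    -- a, a) = g(o, o, a, a)`. Two further applications, to `g`, give `q(a, o) = g(o, a, a, a) =
    -- g(o, o, o, a)`.
    let r : L.Term (Fin 2) := tf.subst ![s, Term.var 1, Term.var 0, s]
    have hr : ∀ v : Fin 2 → X,
        r.realize v = tf.realize ![s.realize v, v 1, v 0, s.realize v] := by
      intro v
      rw [Term.realize_subst]
      congr 1
      funext i
      fin_cases i <;> rfl
    let q : L.Term (Fin 2) := tg.subst ![r, Term.var 0, Term.var 1, r]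
    have hq : ∀ v : Fin 2 → X,
        q.realize v = tg.realize ![r.realize v, v 0, v 1, r.realize v] := by
      intro v
      rw [Term.realize_subst]
      congr 1
      funext i
      fin_cases i <;> rfl
    refine ⟨q, fun a => ?_, fun a => ?_⟩
    · rw [hq, hr]
      change tg.realize ![tf.realize ![_, a, a, _], a, a, tf.realize ![_, a, a, _] ] = o
      rw [hgR, hfR, hs₁]
    · refine Eq.trans ?_ (hg _).symm
      rw [hq]
      change tg.realize ![r.realize ![a, o], a, o, r.realize ![a, o] ] = tg.realize ![o, o, o, a]
      have hr' : r.realize ![a, o] = tg.realize ![o, o, a, a] := by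
        rw [hr, ← hS]
        change tf.realize ![s.realize ![a, o], o, a, s.realize ![a, o] ] = _
        refine Congruence.term_condition hθ tf
          (v := ![s.realize ![a, o], o, o, s.realize ![a, o] ]) (v' := ![o, o, o, a]) ?_ ?_
        · intro i
          fin_cases i <;> simp
        · rw [hfR, hs₂]
      have h₁ : tg.realize ![r.realize ![a, o], a, o, r.realize ![a, o] ]
          = tg.realize ![o, a, a, a] := by
        refine Congruence.term_condition hθ tg
          (v := ![r.realize ![a, o], o, o, r.realize ![a, o] ]) (v' := ![o, o, a, a]) ?_ ?_
        · intro i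
          fin_cases i <;> simp
        · rw [hgR, hr']
      rw [h₁]
      refine Congruence.term_condition hθ tg
        (v := ![a, a, a, a]) (v' := ![a, o, o, a]) ?_ ?_
      · intro i
        fin_cases i <;> simp
      · rw [hgR, hgR]
  · rintro f g ⟨s, hs₁, hs₂⟩ hT
    exact ⟨s, hs₁, fun a => (hs₂ a).trans (hT o o a)⟩

/-- A subtraction term and a diagonal class yield a Mal'tsev homomorphism. -/
theorem isAffine_of_subtraction_term [L.IsAlgebraic]
    (hθ : Set.diagonal X ∈ θ.toSetoid.classes) (o : X) (s : L.Term (Fin 2))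
    (hs₁ : ∀ a : X, s.realize ![a, a] = o) (hs₂ : ∀ a : X, s.realize ![a, o] = a) :
    IsAffine L X := by
  let m : X → X → X := fun a b => s.realize ![a, b]
  have hm₁ : ∀ a, m a a = o := hs₁
  have hm₂ : ∀ a, m a o = a := hs₂
  have hm : ∀ {a b a' b' c d c' d' : X}, θ.toSetoid (a, b) (c, d) → θ.toSetoid (a', b') (c', d') →
      θ.toSetoid (m a a', m b b') (m c c', m d d') := by
    intro a b a' b' c d c' d' h h'
    have key := θ.realize s (v := fun i => (![a, a'] i, ![b, b'] i))
      (w := fun i => (![c, c'] i, ![d, d'] i)) fun i => by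
        fin_cases i
        · exact h
        · exact h'
    rwa [realize_prodMk, realize_prodMk] at key
  have hd : ∀ a b : X, θ.toSetoid (a, a) (b, b) :=
    fun a b => (Congruence.diagonal_iff hθ rfl).2 rfl
  have hsub : ∀ x y, θ.toSetoid (m x y, o) (x, y) := by
    intro x y
    have h := hm (Setoid.refl' _ (x, y)) (hd y o)
    rwa [hm₁, hm₂, hm₂] at h
  have hsub' : ∀ x y, θ.toSetoid (o, m y x) (x, y) := by
    intro x y
    have h := hm (Setoid.refl' _ (x, y)) (hd x o)
    rwa [hm₁, hm₂, hm₂] at h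
  have huniq : ∀ {w w' z : X}, θ.toSetoid (w, z) (w', z) → w = w' := by
    intro w w' z h
    have h' := hm h (Setoid.refl' _ (w', z))
    rw [hm₁, hm₁] at h'
    have h'' : m w w' = m w' w' :=
      ((Congruence.diagonal_iff hθ rfl).1 (Setoid.symm' _ h')).trans (hm₁ w').symm
    have key := Congruence.term_condition hθ s (w := ![w, o]) (w' := ![w', o])
      (fun i => by fin_cases i <;> simp) h''
    rwa [hs₂, hs₂] at key
  -- In additive notation, `z - (0 - (x - y))`.
  let q : X × X × X → X := fun a => m a.2.2 (m o (m a.1 a.2.1))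
  have hq : ∀ a, θ.toSetoid (q a, a.2.2) (a.1, a.2.1) := by
    rintro ⟨x, y, z⟩
    have h := hm (hd z o) (hsub o (m x y))
    rw [hm₂, hm₁] at h
    exact Setoid.trans' _ h (Setoid.trans' _ (hsub' _ _) (hsub x y))
  refine ⟨{ toFun := q, map_fun' := ?_, map_rel' := fun r => isEmptyElim r }, ?_, ?_⟩
  · intro n f a
    -- Both sides of the homomorphism equation solve the same congruence, so `huniq` identifies
    -- them.
    have h := θ.compatible f _ _ fun i => hq (a i)
    exact huniq (Setoid.trans' _ (hq (funMap f a)) (Setoid.symm' _ h))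
  · intro x y
    exact huniq (hq (x, y, y))
  · intro x y
    exact huniq (Setoid.trans' _ (hq (x, x, y)) (hd x y))

end Diagonal

/-- In a pointed variety the constant is fixed by all the operations. -/
theorem Variety.IsPointed.exists_fixed {V : Variety L}
    (h : Variety.IsPointed.{u, v, w} V) {X : Type (max u w)} [L.Structure X]
    (hX : V.Contains X) :
    ∃ (c : L.Term Empty) (o : X), c.realize Empty.elim = o ∧
      ∀ {n : ℕ} (f : L.Functions n), funMap f (fun _ => o) = o := by
  obtain ⟨c, hc⟩ := h
  exact ⟨c, _, rfl, fun f => hc (Term.func f fun _ => c) X hX⟩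

end UnivAlg

theorem mainTheorem7 (L : FirstOrder.Language.{u, v}) [L.IsAlgebraic]
    (V : UnivAlg.Variety L)
    (hpointed : UnivAlg.Variety.IsPointed.{u, v, w} V)
    (hmodular : UnivAlg.Variety.IsCongruenceModular.{u, v, w} V)
    (X : Type (max u w)) [L.Structure X] (hX : V.Contains X) [Nonempty X] :
    (UnivAlg.IsAffine L X ↔
      ∃ θ : UnivAlg.Congruence L (X × X), Set.diagonal X ∈ θ.toSetoid.classes) ∧
    ∀ p : FirstOrder.Language.Hom L (X × X × X) X,
      UnivAlg.IsMaltsev p → UnivAlg.IsAutonomous p := by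
  have := hmodular (X × X × X) (hX.prod (hX.prod hX))
  have := hmodular (X × X × X × X × X) (hX.prod (hX.prod (hX.prod (hX.prod hX))))
  have := hmodular (UnivAlg.TermFunction L (Fin 4) X) (UnivAlg.TermFunction.contains hX)
  obtain ⟨c, o, hc, ho⟩ := hpointed.exists_fixed hX
  have hauto : ∀ p : FirstOrder.Language.Hom L (X × X × X) X,
      UnivAlg.IsMaltsev p → UnivAlg.IsAutonomous p :=
    fun p hp => ⟨hp.assoc, hp.comm⟩
  refine ⟨⟨?_, ?_⟩, hauto⟩
  · rintro ⟨p, hp⟩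
    exact hp.exists_congruence_diagonal (hauto p hp) o ho
  · rintro ⟨θ, hθ⟩
    obtain ⟨s, hs₁, hs₂⟩ := UnivAlg.exists_subtraction_term hθ c o hc
    exact UnivAlg.isAffine_of_subtraction_term hθ o s hs₁ hs₂
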